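/- Let $\mathbb{F}$ be a field. A triassociative algebra over $\mathbb{F}$ is an $\mathbb{F}$-vector space $L$ with three bilinear products $\vdash,\dashv,\perp\colon L\times L\to L$ such that, for all $x,y,z\in L$, $$\begin{aligned} &(x\vdash y)\vdash z=(x\dashv y)\vdash z=(x\perp y)\vdash z=x\vdash(y\vdash z),\\ &(x\dashv y)\dashv z=x\dashv(y\dashv z)=x\dashv(y\vdash z)=x\dashv(y\perp z),\\ &(x\vdash y)\dashv z=x\vdash(y\dashv z),\qquad (x\vdash y)\perp z=x\vdash(y\perp z),\\ &(x\dashv y)\perp z=x\perp(y\vdash z),\qquad (x\perp y)\dashv z=x\perp(y\dashv z),\\ &(x\perp y)\perp z=x\perp(y\perp z). \end{aligned}$$ Homomorphisms are linear maps that preserve the three products. The center $Z(L)$ is the set of all $z\in L$ with $z*x=x*z=0$ for all $x\in L$ and $*\in\{\vdash,\dashv,\perp\}$, and $L'$ is the linear span of all products $x*y$ with $x,y\in L$ and $*\in\{\vdash,\dashv,\perp\}$. A central extension of $L$ is a short exact sequence $0\to\ker\omega\to E\xrightarrow{\omega}L\to0$ of triassociative algebras, with $\omega$ a surjective homomorphism,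 such that $\ker\omega\subseteq Z(E)$; it is a stem extension if moreover $\ker\omega\subseteq E'$. Let $Z^*(L)$ be the intersection of the images $\omega(Z(E))$ over all central extensions $0\to\ker\omega\to E\xrightarrow{\omega}L\to0$ of $L$. **Theorem.** Let $L$ be a triassociative algebra over $\mathbb{F}$ (of any dimension). If $Z(L)\subseteq Z^*(L)$, then $\omega(Z(E))=Z(L)$ for every stem extension $0\to\ker\omega\to E\xrightarrow{\omega}L\to0$ of $L$. -/

import Mathlib

universe u v w

/-- A triassociative algebra over a field `F`: a vector space `L` with three bilinear products
`vdash` (⊢), `dashv` (⊣) and `perp` (⊥) subject to the eleven triassociativity relations. -/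
class TriassociativeAlgebra (F : Type u) (L : Type v) [Field F] [AddCommGroup L] [Module F L] where
  vdash : L →ₗ[F] L →ₗ[F] L
  dashv : L →ₗ[F] L →ₗ[F] L
  perp : L →ₗ[F] L →ₗ[F] L
  vdash_vdash (x y z : L) : vdash (vdash x y) z = vdash x (vdash y z)
  dashv_vdash (x y z : L) : vdash (dashv x y) z = vdash x (vdash y z)
  vdash_dashv (x y z : L) : dashv (vdash x y) z = vdash x (dashv y z)
  perp_vdash (x y z : L) : vdash (perp x y) z = vdash x (vdash y z)
  vdash_perp (x y z : L) : perp (vdash x y) z = vdash x (perp y z)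
  dashv_perp (x y z : L) : perp (dashv x y) z = perp x (vdash y z)
  perp_perp (x y z : L) : perp (perp x y) z = perp x (perp y z)
  dashv_dashv (x y z : L) : dashv (dashv x y) z = dashv x (dashv y z)
  dashv_dashv_vdash (x y z : L) : dashv (dashv x y) z = dashv x (vdash y z)
  dashv_dashv_perp (x y z : L) : dashv (dashv x y) z = dashv x (perp y z)
  perp_dashv (x y z : L) : dashv (perp x y) z = perp x (dashv y z)

namespace TriassociativeAlgebra

section Basic

variable (F : Type u) (L : Type v) [Field F] [AddCommGroup L] [Module F L]
  [TriassociativeAlgebra F L]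

/-- The center `Z(L)`: all `z` with `z * x = x * z = 0` for all `x` and all three products. -/
def center : Submodule F L where
  carrier := {z | ∀ x : L,
    (vdash (F := F) z x = 0 ∧ vdash (F := F) x z = 0) ∧
    (dashv (F := F) z x = 0 ∧ dashv (F := F) x z = 0) ∧
    (perp (F := F) z x = 0 ∧ perp (F := F) x z = 0)}
  zero_mem' := by
    intro x
    simp
  add_mem' := by
    intro a b ha hb x
    obtain ⟨⟨h1, h2⟩, ⟨h3, h4⟩, h5, h6⟩ := ha x
    obtain ⟨⟨k1, k2⟩, ⟨k3, k4⟩, k5, k6⟩ := hb x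
    simp [h1, h2, h3, h4, h5, h6, k1, k2, k3, k4, k5, k6]
  smul_mem' := by
    intro c a ha x
    obtain ⟨⟨h1, h2⟩, ⟨h3, h4⟩, h5, h6⟩ := ha x
    simp [h1, h2, h3, h4, h5, h6]

variable {F L} in
/-- `S ◊ T = S ⊢ T + S ⊣ T + S ⊥ T`, where `S * T` is the span of the products `s * t` with
`s ∈ S` and `t ∈ T`. -/
def lozenge (S T : Submodule F L) : Submodule F L :=
  Submodule.map₂ vdash S T ⊔ Submodule.map₂ dashv S T ⊔ Submodule.map₂ perp S T

/-- The derived ideal `L' = L ◊ L`. -/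
def derived : Submodule F L := lozenge (⊤ : Submodule F L) ⊤

end Basic

/-- Homomorphisms of triassociative algebras: linear maps preserving the three products. -/
structure Hom (F : Type u) (E : Type v) (L : Type w) [Field F]
    [AddCommGroup E] [Module F E] [TriassociativeAlgebra F E]
    [AddCommGroup L] [Module F L] [TriassociativeAlgebra F L] extends E →ₗ[F] L where
  map_vdash (x y : E) :
    toLinearMap (vdash (F := F) x y) = vdash (F := F) (toLinearMap x) (toLinearMap y)
  map_dashv (x y : E) :
    toLinearMap (dashv (F := F) x y) = dashv (F := F) (toLinearMap x) (toLinearMap y)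
  map_perp (x y : E) :
    toLinearMap (perp (F := F) x y) = perp (F := F) (toLinearMap x) (toLinearMap y)

section Extension

variable {F : Type u} {E : Type v} {L : Type w} [Field F]
  [AddCommGroup E] [Module F E] [TriassociativeAlgebra F E]
  [AddCommGroup L] [Module F L] [TriassociativeAlgebra F L]

/-- `0 → ker ω → E → L → 0` is a central extension of `L`: it is exact, that is, `ω` is
surjective, and `ker ω ⊆ Z(E)`. -/
def IsCentralExtension (ω : Hom F E L) : Prop :=
  Function.Surjective ω.toLinearMap ∧ LinearMap.ker ω.toLinearMap ≤ center F E

/-- `0 → ker ω → E → L → 0` is a stem extension of `L`: it is central and `ker ω ⊆ E'`. -/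
def IsStemExtension (ω : Hom F E L) : Prop :=
  IsCentralExtension ω ∧ LinearMap.ker ω.toLinearMap ≤ derived F E

end Extension

/-- `Z^*(L)`: the intersection of the images `ω(Z(E))` over all central extensions
`0 → ker ω → E → L → 0`. The universe of `E` is one that holds the free triassociative algebra
on `L`; central extensions in other universes do not make the intersection smaller. -/
def zStar (F : Type u) (L : Type v) [Field F] [AddCommGroup L] [Module F L]
    [TriassociativeAlgebra F L] : Submodule F L :=
  sInf {S : Submodule F L |
    ∃ (E : Type (max u v)) (_ : AddCommGroup E) (_ : Module F E) (_ : TriassociativeAlgebra F E)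
      (ω : Hom F E L), IsCentralExtension ω ∧ S = (center F E).map ω.toLinearMap}

end TriassociativeAlgebra

/-! Surjectivity of `ω` puts `ω(Z(E))` inside `Z(L)`. Conversely, `E` is itself a central extension
of `L`, so `Z(L) ⊆ Z^*(L) ⊆ ω(Z(E))`. The only gap is one of size: `zStar` ranges over `Type (max u
v)`, while `E` may live in any universe. The stem condition closes it: modulo `ker ω ⊆ E'` every
element of `E` comes from a section of `ω`, and by centrality `E'` is spanned by products of section
values. Thus `E` has a spanning family indexed by a set built from `L`, and its structure transports
to a linear copy in the right universe. -/

namespace TriassociativeAlgebra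

section Transport

variable {F : Type u} {E : Type v} {M : Type w} [Field F]
  [AddCommGroup E] [Module F E] [AddCommGroup M] [Module F M]

/-- A bilinear product on `E`, transported to `M` along a linear equivalence. -/
def transportProduct (e : M ≃ₗ[F] E) (p : E →ₗ[F] E →ₗ[F] E) : M →ₗ[F] M →ₗ[F] M :=
  (p.compl₁₂ e.toLinearMap e.toLinearMap).compr₂ e.symm.toLinearMap

@[simp]
theorem transportProduct_apply (e : M ≃ₗ[F] E) (p : E →ₗ[F] E →ₗ[F] E) (x y : M) :
    transportProduct e p x y = e.symm (p (e x) (e y)) := rfl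

variable [TriassociativeAlgebra F E]

/-- The triassociative structure of `E`, transported to `M` along a linear equivalence. -/
abbrev transport (e : M ≃ₗ[F] E) : TriassociativeAlgebra F M where
  vdash := transportProduct e vdash
  dashv := transportProduct e dashv
  perp := transportProduct e perp
  vdash_vdash x y z := by simp [vdash_vdash]
  dashv_vdash x y z := by simp [dashv_vdash]
  vdash_dashv x y z := by simp [vdash_dashv]
  perp_vdash x y z := by simp [perp_vdash]
  vdash_perp x y z := by simp [vdash_perp]
  dashv_perp x y z := by simp [dashv_perp]
  perp_perp x y z := by simp [perp_perp]
  dashv_dashv x y z := by simp [dashv_dashv]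
  dashv_dashv_vdash x y z := by simp [dashv_dashv_vdash]
  dashv_dashv_perp x y z := by simp [dashv_dashv_perp]
  perp_dashv x y z := by simp [perp_dashv]

theorem mem_center_transport (e : M ≃ₗ[F] E) (m : M) :
    letI := transport e
    m ∈ center F M ↔ e m ∈ center F E := by
  let := transport e
  change (∀ x : M,
    (e.symm (vdash (F := F) (e m) (e x)) = 0 ∧ e.symm (vdash (F := F) (e x) (e m)) = 0) ∧
    (e.symm (dashv (F := F) (e m) (e x)) = 0 ∧ e.symm (dashv (F := F) (e x) (e m)) = 0) ∧
    (e.symm (perp (F := F) (e m) (e x)) = 0 ∧ e.symm (perp (F := F) (e x) (e m)) = 0)) ↔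
    ∀ x : E,
      (vdash (F := F) (e m) x = 0 ∧ vdash (F := F) x (e m) = 0) ∧
      (dashv (F := F) (e m) x = 0 ∧ dashv (F := F) x (e m) = 0) ∧
      (perp (F := F) (e m) x = 0 ∧ perp (F := F) x (e m) = 0)
  simp only [LinearEquiv.map_eq_zero_iff]
  exact e.surjective.forall
    (p := fun x : E => (vdash (F := F) (e m) x = 0 ∧ vdash (F := F) x (e m) = 0) ∧
      (dashv (F := F) (e m) x = 0 ∧ dashv (F := F) x (e m) = 0) ∧
      (perp (F := F) (e m) x = 0 ∧ perp (F := F) x (e m) = 0)) |>.symm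

end Transport

section Extension

variable {F : Type u} {E : Type w} {L : Type v} [Field F]
  [AddCommGroup E] [Module F E] [TriassociativeAlgebra F E]
  [AddCommGroup L] [Module F L] [TriassociativeAlgebra F L]

/-- Every element of `L` lifts to `E`, so its products with `ω z` are images of products with `z`,
which vanish. -/
theorem map_center_le_center (ω : Hom F E L) (hω : Function.Surjective ω.toLinearMap) :
    (center F E).map ω.toLinearMap ≤ center F L := by
  rintro _ ⟨z, hz, rfl⟩ x
  obtain ⟨y, rfl⟩ := hω x
  obtain ⟨⟨h1, h2⟩, ⟨h3, h4⟩, h5, h6⟩ := hz y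
  simp only [← ω.map_vdash, ← ω.map_dashv, ← ω.map_perp, h1, h2, h3, h4, h5, h6, map_zero,
    and_self]

/-- `Z^*(L)` lies in the image of the center of a central extension which is linearly isomorphic
to a space in the universe used in the definition of `Z^*(L)`. -/
theorem zStar_le_map_center_of_equiv (ω : Hom F E L) (hω : IsCentralExtension ω)
    {M : Type (max u v)} [AddCommGroup M] [Module F M] (e : M ≃ₗ[F] E) :
    zStar F L ≤ (center F E).map ω.toLinearMap := by
  let := transport e
  let ψ : Hom F M L :=
    { toLinearMap := ω.toLinearMap ∘ₗ e.toLinearMap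
      map_vdash := fun x y => by
        change ω.toLinearMap (e (e.symm (vdash (F := F) (e x) (e y)))) = _
        rw [e.apply_symm_apply, ω.map_vdash]; rfl
      map_dashv := fun x y => by
        change ω.toLinearMap (e (e.symm (dashv (F := F) (e x) (e y)))) = _
        rw [e.apply_symm_apply, ω.map_dashv]; rfl
      map_perp := fun x y => by
        change ω.toLinearMap (e (e.symm (perp (F := F) (e x) (e y)))) = _
        rw [e.apply_symm_apply, ω.map_perp]; rfl }
  have hψ : IsCentralExtension ψ :=
    ⟨hω.1.comp e.surjective, fun m hm => (mem_center_transport e m).2 (hω.2 hm)⟩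
  refine (sInf_le ⟨M, _, _, _, ψ, hψ, rfl⟩ : zStar F L ≤ _).trans ?_
  rintro _ ⟨m, hm, rfl⟩
  exact ⟨e m, (mem_center_transport e m).1 hm, rfl⟩

/-- In a central extension, products depend only on the images of the factors, so `E'` is spanned
by the products of the elements of a section. -/
theorem derived_le_span_section (ω : Hom F E L) (hω : IsCentralExtension ω) (s : L → E)
    (hs : ∀ a, ω.toLinearMap (s a) = a) :
    derived F E ≤ Submodule.span F
      (Set.range fun q : L × L => vdash (F := F) (s q.1) (s q.2)) ⊔ Submodule.span F
      (Set.range fun q : L × L => dashv (F := F) (s q.1) (s q.2)) ⊔ Submodule.span F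
      (Set.range fun q : L × L => perp (F := F) (s q.1) (s q.2)) := by
  have hc (x : E) : x - s (ω.toLinearMap x) ∈ center F E :=
    hω.2 (by rw [LinearMap.mem_ker, map_sub, hs, sub_self])
  have key (p : E →ₗ[F] E →ₗ[F] E)
      (hp : ∀ z ∈ center F E, ∀ x, p z x = 0 ∧ p x z = 0) :
      Submodule.map₂ p ⊤ ⊤ ≤ Submodule.span F (Set.range fun q : L × L => p (s q.1) (s q.2)) := by
    rw [Submodule.map₂_le]
    intro x _ y _
    -- Each factor differs from its section value by a central element, so the factors can be
    -- replaced one at a time.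
    refine Submodule.subset_span ⟨(ω.toLinearMap x, ω.toLinearMap y), ?_⟩
    have h1 := (hp _ (hc x) y).1
    have h2 := (hp _ (hc y) (s (ω.toLinearMap x))).2
    rw [map_sub, LinearMap.sub_apply, sub_eq_zero] at h1
    rw [map_sub, sub_eq_zero] at h2
    exact (h1.trans h2).symm
  exact sup_le_sup (sup_le_sup (key _ fun z hz x => (hz x).1) (key _ fun z hz x => (hz x).2.1))
    (key _ fun z hz x => (hz x).2.2)

/-- A stem extension of `L` is linearly isomorphic to a space in the universe used in the
definition of `Z^*(L)`. -/
theorem exists_linearEquiv_of_isStemExtension (ω : Hom F E L) (hω : IsStemExtension ω) :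
    ∃ (M : Type (max u v)) (_ : AddCommGroup M) (_ : Module F M), Nonempty (M ≃ₗ[F] E) := by
  choose s hs using hω.1.1
  -- Generators: the section values and, for each of the three operations, their pairwise products.
  let g : (L ⊕ ((L × L) ⊕ (L × L)) ⊕ (L × L)) → E :=
    Sum.elim s (Sum.elim (Sum.elim (fun q => vdash (F := F) (s q.1) (s q.2))
      (fun q => dashv (F := F) (s q.1) (s q.2))) (fun q => perp (F := F) (s q.1) (s q.2)))
  have hg : Function.Surjective (Finsupp.linearCombination F g) := by
    rw [← LinearMap.range_eq_top, Finsupp.range_linearCombination, eq_top_iff]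
    intro x _
    have hx : x - s (ω.toLinearMap x) ∈ derived F E :=
      hω.2 (by rw [LinearMap.mem_ker, map_sub, hs, sub_self])
    have hd := derived_le_span_section ω hω.1 s hs hx
    simp only [g, Set.Sum.elim_range, Submodule.span_union]
    rw [← sub_add_cancel x (s (ω.toLinearMap x))]
    exact add_mem (Submodule.mem_sup_right hd)
      (Submodule.mem_sup_left (Submodule.subset_span ⟨_, rfl⟩))
  -- The index type lies in the universe of `L`, so this quotient of finitely supported functions
  -- lies in `Type (max u v)`.
  exact ⟨_ ⧸ LinearMap.ker (Finsupp.linearCombination F g), inferInstance, inferInstance,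
    ⟨(Finsupp.linearCombination F g).quotKerEquivOfSurjective hg⟩⟩

end Extension

end TriassociativeAlgebra

theorem mainTheorem7 {F : Type u} {L : Type v} [Field F]
    [AddCommGroup L] [Module F L] [TriassociativeAlgebra F L]
    (hL : TriassociativeAlgebra.center F L ≤ TriassociativeAlgebra.zStar F L)
    {E : Type w} [AddCommGroup E] [Module F E] [TriassociativeAlgebra F E]
    (ω : TriassociativeAlgebra.Hom F E L) (hω : TriassociativeAlgebra.IsStemExtension ω) :
    (TriassociativeAlgebra.center F E).map ω.toLinearMap = TriassociativeAlgebra.center F L := by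
  obtain ⟨M, _, _, ⟨e⟩⟩ := TriassociativeAlgebra.exists_linearEquiv_of_isStemExtension ω hω
  exact le_antisymm (TriassociativeAlgebra.map_center_le_center ω hω.1.1)
    (hL.trans (TriassociativeAlgebra.zStar_le_map_center_of_equiv ω hω.1 e))
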